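/- Fix $\nu,\alpha,\beta,\sigma^2>0$ and an integer $d\ge 1$. For $\phi,\tau^2>0$ let $$\mathcal M(h;\nu,\phi,\tau^2)=\tau^2\,\frac{2^{1-\nu}}{\Gamma(\nu)}\Big(\frac{\sqrt{2\nu}}{\phi}h\Big)^{\nu}\mathcal K_\nu\Big(\frac{\sqrt{2\nu}}{\phi}h\Big)\quad (h>0),\qquad \mathcal M(0;\nu,\phi,\tau^2)=\tau^2,$$ be the Matérn covariance function, where $\mathcal K_\nu$ is the modified Bessel function of the second kind. The Confluent Hypergeometric (CH) covariance function is the mixture of Matérn covariances over an inverse gamma distribution for $\phi^2$ with shape $\alpha$ and scale $\beta^2/2$: $$C(h)=C(h;\nu,\alpha,\beta,\sigma^2)=\int_0^\infty \mathcal M(h;\nu,\sqrt v,\sigma^2)\,\frac{(\beta^2/2)^{\alpha}}{\Gamma(\alpha)}\,v^{-\alpha-1}e^{-\beta^2/(2v)}\,dv,\qquad h\ge 0.$$ **(a) Origin behavior.** The differentiability of the CH class is controlled by $\nu$ alone, in the same way as for the Matérn class. That is, for each of the functions $F=C(\cdot\,;\nu,\alpha,\beta,\sigma^2)$ and $F=\mathcal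 M(\cdot\,;\nu,\phi,\tau^2)$ (with any $\phi,\tau^2>0$) and for every integer $m\ge 0$: - the even function $h\mapsto F(|h|)$ on $\mathbb R$ is $2m$ times differentiable at $h=0$ if and only if $m<\nu$; - if $Z$ is a square-integrable random field on $\mathbb R^d$ with constant mean and with $\operatorname{cov}(Z(\mathbf s),Z(\mathbf t))=F(|\mathbf s-\mathbf t|)$ for all $\mathbf s,\mathbf t$, then $Z$ is $m$ times mean-square differentiable (all iterated mean-square directional derivatives of order at most $m$ exist) if and only if $m<\nu$; also, for every fixed direction $\mathbf e\neq 0$, $Z$ is $m$ times mean-square differentiable in the direction $\mathbf e$ if and only if $m<\nu$. In particular, if $\nu$ is not an integer, such a field is exactly $\lfloor\nu\rfloor$ times mean-square differentiable. **(b) Tail behavior.** The function $L(x)=\{x/(x+\beta^2/(2\nu))\}^{\nu+\alpha}$ is slowly varying at $\infty$, and $$C(h;\nu,\alpha,\beta,\sigma^2)\sim\frac{\sigma^2\beta^{2\alpha}\,\Gamma(\nu+\alpha)}{\nu^{\alpha}\,\Gamma(\nu)}\,|h|^{-2\alpha}L(h^2)\qquad\text{as } h\to\infty,$$ i.e. the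 ratio of the two sides tends to $1$. -/

import Mathlib

open Real Set Filter Topology MeasureTheory ProbabilityTheory Asymptotics
open scoped ENNReal

universe u

noncomputable section

/-! ### Covariance functions -/

/-- The modified Bessel function of the second kind, for real order `p` and argument `z > 0`:
`K_p(z) = ½ ∫₀^∞ x^(p-1) exp(-z (x + 1/x) / 2) dx`. -/
def besselK (p z : ℝ) : ℝ :=
  (1 / 2) * ∫ x in Ioi (0 : ℝ), x ^ (p - 1) * exp (-(z * (x + 1 / x)) / 2)

/-- The Matérn covariance at distance `h ≥ 0`, with smoothness `ν`, range `φ` and variance `σsq`.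
At `h = 0` it has the value `σsq`, which is the limit of the formula as `h → 0+`. -/
def maternCov (ν φ σsq h : ℝ) : ℝ :=
  if h = 0 then σsq
  else σsq * ((2 : ℝ) ^ (1 - ν) / Gamma ν) * (√(2 * ν) / φ * h) ^ ν *
    besselK ν (√(2 * ν) / φ * h)

/-- The density at `x > 0` of the inverse gamma distribution with shape `a` and scale `b`. -/
def invGammaDensity (a b x : ℝ) : ℝ :=
  b ^ a / Gamma a * x ^ (-a - 1) * exp (-b / x)

/-- The Confluent Hypergeometric (CH) covariance at distance `h ≥ 0`, with smoothness `ν`, tail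
decay `α`, scale `β` and variance `σsq`: the Matérn covariance with `φ²` (the variable `v` below)
mixed over the inverse gamma distribution with shape `α` and scale `β² / 2`. -/
def chCov (ν α β σsq h : ℝ) : ℝ :=
  ∫ v in Ioi (0 : ℝ), maternCov ν (√v) σsq h * invGammaDensity α (β ^ 2 / 2) v

/-! ### Differentiability of a function of one variable at a point -/

/-- `f` is `k` times differentiable at `x`: for `k = j + 1`, it is `j` times differentiable at
all points near `x`, and its `j`-th derivative is differentiable at `x`. -/
def TimesDifferentiableAt : ℕ → (ℝ → ℝ) → ℝ → Prop
  | 0, _, _ => True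
  | k + 1, f, x =>
      (∀ᶠ y in 𝓝 x, TimesDifferentiableAt k f y) ∧ DifferentiableAt ℝ (iteratedDeriv k f) x

/-! ### Random fields and mean-square differentiability -/

/-- `Z` is a square-integrable random field on `ℝ^d` with constant mean and with the isotropic
covariance `cov(Z(s), Z(t)) = C(|s - t|)`. -/
structure IsIsotropicField {d : ℕ} {Ω : Type u} [MeasurableSpace Ω] (P : Measure Ω)
    (Z : EuclideanSpace ℝ (Fin d) → Ω → ℝ) (C : ℝ → ℝ) : Prop where
  memLp : ∀ s, MemLp (Z s) 2 P
  mean : ∃ c : ℝ, ∀ s, ∫ ω, Z s ω ∂P = c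
  cov : ∀ s t, covariance (Z s) (Z t) P = C ‖s - t‖

/-- The field `Z'` is the mean-square derivative of the field `Z` in the direction `u`: at every
`s`, `(Z(s + t u) - Z(s)) / t → Z'(s)` in mean square as `t → 0`. -/
def HasMSDerivAlong {d : ℕ} {Ω : Type u} [MeasurableSpace Ω] (P : Measure Ω)
    (Z Z' : EuclideanSpace ℝ (Fin d) → Ω → ℝ) (u : EuclideanSpace ℝ (Fin d)) : Prop :=
  ∀ s, Tendsto (fun t : ℝ => eLpNorm (fun ω => (Z (s + t • u) ω - Z s ω) / t - Z' s ω) 2 P)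
    (𝓝[≠] 0) (𝓝 0)

/-- `Z` is `m` times mean-square differentiable: all its iterated mean-square directional
derivatives of order up to `m` exist (in arbitrary, possibly different, directions). -/
def IsMSDifferentiable {d : ℕ} {Ω : Type u} [MeasurableSpace Ω] (P : Measure Ω) :
    ℕ → (EuclideanSpace ℝ (Fin d) → Ω → ℝ) → Prop
  | 0, Z => ∀ s, MemLp (Z s) 2 P
  | m + 1, Z => (∀ s, MemLp (Z s) 2 P) ∧
      ∀ u, ∃ Z', HasMSDerivAlong P Z Z' u ∧ IsMSDifferentiable P m Z'

/-- `Z` is `m` times mean-square differentiable in the single direction `u`. -/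
def IsMSDifferentiableAlong {d : ℕ} {Ω : Type u} [MeasurableSpace Ω] (P : Measure Ω)
    (u : EuclideanSpace ℝ (Fin d)) : ℕ → (EuclideanSpace ℝ (Fin d) → Ω → ℝ) → Prop
  | 0, Z => ∀ s, MemLp (Z s) 2 P
  | m + 1, Z => (∀ s, MemLp (Z s) 2 P) ∧
      ∃ Z', HasMSDerivAlong P Z Z' u ∧ IsMSDifferentiableAlong P u m Z'

/-! ### Slow variation -/

/-- `L` is slowly varying at `∞`: it is positive and measurable on some `[a, ∞)`, and
`L(t x) / L(x) → 1` as `x → ∞` for every `t > 0`. -/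
def IsSlowlyVarying (L : ℝ → ℝ) : Prop :=
  (∃ a : ℝ, (∀ x, a ≤ x → 0 < L x) ∧ Measurable ((Ici a).domRestrict L)) ∧
    ∀ t : ℝ, 0 < t → Tendsto (fun x => L (t * x) / L x) atTop (𝓝 1)

/-- The function `L(x) = {x / (x + β² / (2ν))}^(ν + α)`. -/
def chSlow (ν α β x : ℝ) : ℝ :=
  (x / (x + β ^ 2 / (2 * ν))) ^ (ν + α)

end

/-! ### Cosine transforms of one variable -/

section CosineTransform

variable {Θ : Type*} [MeasurableSpace Θ] {μ : Measure Θ} {q T : Θ → ℝ}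

/-! Both covariances are scale mixtures of Gaussians, `F(h) = σ² E exp(-X h²)`. With `S ~ Gamma(ν,
1)`, the Matérn class has `X = ν / (2 φ² S)`, by a substitution in the Bessel integral
(`maternCov_eq_integral`). The CH class has `X = (ν / 2) Y / S` with an independent `Y ~ Gamma(α, β²
/ 2)` (`chCov_eq_integral`). If `G` is standard normal, then `F(|v|) = σ² E cos⟨v, √(2X) G⟩`, so the
spectral measure is `σ²` times the law of `√(2X) G`.

Differentiability at the origin (`timesDifferentiableAt_integral_cos_iff`) and mean-square
differentiability (`HasSpectralMoments.isMSDifferentiable`,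
`HasSpectralMoments.integrable_of_isMSDifferentiableAlong`) both amount to finite spectral moments
of order `2m`. Existence of derivatives comes from dominated convergence, necessity from Fatou. By
Fubini the moment condition is `E X^m < ∞`. Since `Y` has all positive moments, it reduces to `E
S^(-m) < ∞`, that is, `m < ν`.

For the tail, integrating out `Y` leaves `C(h) = σ² E (b / (b + ν h² / (2S)))^α` with `b = β² / 2`.
Multiplying by `h^(2α)` and passing to the limit gives `σ² (β² / ν)^α E S^α`
(`tendsto_rpow_mul_chCov`). The factor `L(h²)` tends to 1, hence is harmless. -/

lemma tendsto_one_sub_cos_div_sq (x : ℝ) :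
    Tendsto (fun t : ℝ => (2 - 2 * cos (t * x)) / t ^ 2) (𝓝[≠] 0) (𝓝 (x ^ 2)) := by
  have h1 : Tendsto (fun t : ℝ => t⁻¹ * (sin (t * (x / 2)))) (𝓝[≠] 0) (𝓝 (x / 2)) := by
    have : HasDerivAt (fun t : ℝ => sin (t * (x / 2))) (x / 2) 0 := by
      simpa using ((hasDerivAt_id (0 : ℝ)).mul_const (x / 2)).sin
    simpa using this.tendsto_slope_zero
  have h2 := ((h1.pow 2).const_mul 4)
  convert! h2 using 2 with t
  · have : cos (t * x) = 1 - 2 * sin (t * (x / 2)) ^ 2 := by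
      rw [show t * x = 2 * (t * (x / 2)) by ring, cos_two_mul, cos_sq']; ring
    rw [this, mul_pow, inv_pow]; ring
  · ring

/-- If the second symmetric difference quotients of the cosine transform of a nonnegative weight
are bounded along a sequence tending to `0`, then the weight has a second moment. -/
lemma integrable_mul_sq_of_bounded (hq : Measurable q) (hq0 : 0 ≤ q) (hT : Measurable T)
    (hqi : Integrable q μ) {t : ℕ → ℝ} (ht : Tendsto t atTop (𝓝[≠] 0)) {B : ℝ}
    (hB : ∀ᶠ n in atTop, ∫ θ, q θ * ((2 - 2 * cos (t n * T θ)) / t n ^ 2) ∂μ ≤ B) :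
    Integrable (fun θ => q θ * T θ ^ 2) μ := by
  have hnn : ∀ n θ, 0 ≤ q θ * ((2 - 2 * cos (t n * T θ)) / t n ^ 2) := fun n θ =>
    mul_nonneg (hq0 θ) (div_nonneg (by linarith [cos_le_one (t n * T θ)]) (sq_nonneg _))
  refine ⟨by fun_prop, ?_⟩
  rw [hasFiniteIntegral_iff_ofReal (Eventually.of_forall fun θ => mul_nonneg (hq0 θ) (sq_nonneg _))]
  have hlim : ∀ θ, Tendsto (fun n => ENNReal.ofReal (q θ * ((2 - 2 * cos (t n * T θ)) / t n ^ 2)))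
      atTop (𝓝 (ENNReal.ofReal (q θ * T θ ^ 2))) := fun θ =>
    ENNReal.tendsto_ofReal (((tendsto_one_sub_cos_div_sq (T θ)).comp ht).const_mul _)
  -- Fatou: the nonnegative quotients converge pointwise to `q T²`.
  calc ∫⁻ θ, ENNReal.ofReal (q θ * T θ ^ 2) ∂μ
      = ∫⁻ θ, liminf (fun n => ENNReal.ofReal (q θ * ((2 - 2 * cos (t n * T θ)) / t n ^ 2)))
          atTop ∂μ := lintegral_congr fun θ => (hlim θ).liminf_eq.symm
    _ ≤ liminf (fun n => ∫⁻ θ, ENNReal.ofReal (q θ * ((2 - 2 * cos (t n * T θ)) / t n ^ 2)) ∂μ)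
          atTop := lintegral_liminf_le fun n => by fun_prop
    _ ≤ liminf (fun _ : ℕ => ENNReal.ofReal B) atTop := by
        refine liminf_le_liminf ?_
        filter_upwards [hB] with n hn
        rw [← ofReal_integral_eq_lintegral_ofReal]
        · exact ENNReal.ofReal_le_ofReal hn
        · refine hqi.mul_bdd (c := 4 / t n ^ 2) (by fun_prop) (Eventually.of_forall fun θ => ?_)
          rw [norm_div, Real.norm_eq_abs, Real.norm_eq_abs, abs_of_nonneg (sq_nonneg (t n))]
          gcongr
          rw [abs_le]
          constructor <;> linarith [cos_le_one (t n * T θ), neg_one_le_cos (t n * T θ)]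
        · exact Eventually.of_forall (hnn n)
    _ = ENNReal.ofReal B := by simp
    _ < ⊤ := ENNReal.ofReal_lt_top

lemma integrable_mul_self_of_integrable_mul_sq (hq : Measurable q) (hT : Measurable T)
    (hqi : Integrable q μ) (h2 : Integrable (fun θ => q θ * T θ ^ 2) μ) :
    Integrable (fun θ => q θ * T θ) μ := by
  refine (hqi.norm.add h2.norm).mono' (by fun_prop) (Eventually.of_forall fun θ => ?_)
  simp only [Pi.add_apply, norm_mul, norm_pow]
  nlinarith [mul_nonneg (norm_nonneg (q θ)) (sq_nonneg (‖T θ‖ - 1)),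
    mul_nonneg (norm_nonneg (q θ)) (sq_nonneg (‖T θ‖)), norm_nonneg (q θ)]

lemma hasDerivAt_integral_cos (hq : Measurable q) (hT : Measurable T) (hqi : Integrable q μ)
    (h1 : Integrable (fun θ => q θ * T θ) μ) (h : ℝ) :
    HasDerivAt (fun h => ∫ θ, q θ * cos (h * T θ) ∂μ) (∫ θ, -(q θ * T θ * sin (h * T θ)) ∂μ) h := by
  refine (hasDerivAt_integral_of_dominated_loc_of_deriv_le (bound := fun θ => ‖q θ * T θ‖)
    (F' := fun h θ => -(q θ * T θ * sin (h * T θ))) univ_mem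
    (Eventually.of_forall fun h => by fun_prop) ?_ (by fun_prop) ?_ h1.norm ?_).2
  · refine hqi.mul_bdd (c := 1) (by fun_prop) (Eventually.of_forall fun θ => ?_)
    exact abs_cos_le_one _
  · refine Eventually.of_forall fun θ x _ => ?_
    rw [norm_neg, norm_mul (q θ * T θ)]
    exact mul_le_of_le_one_right (norm_nonneg _) (abs_sin_le_one _)
  · refine Eventually.of_forall fun θ x _ => ?_
    convert! (((hasDerivAt_id x).mul_const (T θ)).cos.const_mul (q θ)) using 1
    simp; ring

lemma hasDerivAt_integral_sin (hq : Measurable q) (hT : Measurable T) (hqi : Integrable q μ)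
    (h1 : Integrable (fun θ => q θ * T θ) μ) (h : ℝ) :
    HasDerivAt (fun h => ∫ θ, q θ * sin (h * T θ) ∂μ) (∫ θ, q θ * T θ * cos (h * T θ) ∂μ) h := by
  refine (hasDerivAt_integral_of_dominated_loc_of_deriv_le (bound := fun θ => ‖q θ * T θ‖)
    (F' := fun h θ => q θ * T θ * cos (h * T θ)) univ_mem
    (Eventually.of_forall fun h => by fun_prop) ?_ (by fun_prop) ?_ h1.norm ?_).2
  · refine hqi.mul_bdd (c := 1) (by fun_prop) (Eventually.of_forall fun θ => ?_)
    exact abs_sin_le_one _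
  · refine Eventually.of_forall fun θ x _ => ?_
    rw [norm_mul (q θ * T θ)]
    exact mul_le_of_le_one_right (norm_nonneg _) (abs_cos_le_one _)
  · refine Eventually.of_forall fun θ x _ => ?_
    convert! (((hasDerivAt_id x).mul_const (T θ)).sin.const_mul (q θ)) using 1
    simp; ring

end CosineTransform

/-! ### Repeated differentiability at a point -/

lemma TimesDifferentiableAt.of_succ {k : ℕ} {f : ℝ → ℝ} {x : ℝ}
    (h : TimesDifferentiableAt (k + 1) f x) : TimesDifferentiableAt k f x :=
  h.1.self_of_nhds

lemma TimesDifferentiableAt.of_le {k l : ℕ} (hkl : k ≤ l) {f : ℝ → ℝ} {x : ℝ}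
    (h : TimesDifferentiableAt l f x) : TimesDifferentiableAt k f x := by
  induction l, hkl using Nat.le_induction with
  | base => exact h
  | succ l _ ih => exact ih h.of_succ

/-- The definition peels off the last derivative; an induction through explicit formulas for `deriv
f` needs to peel off the first. -/
lemma timesDifferentiableAt_succ_iff_deriv {f : ℝ → ℝ} (hf : Differentiable ℝ f) (k : ℕ) (x : ℝ) :
    TimesDifferentiableAt (k + 1) f x ↔ TimesDifferentiableAt k (deriv f) x := by
  induction k generalizing x with
  | zero => simp [TimesDifferentiableAt, hf x]
  | succ k ih =>
    rw [TimesDifferentiableAt, TimesDifferentiableAt, iteratedDeriv_succ']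
    simp_rw [ih]

lemma timesDifferentiableAt_neg_iff {f : ℝ → ℝ} (k : ℕ) (x : ℝ) :
    TimesDifferentiableAt k (fun y => -f y) x ↔ TimesDifferentiableAt k f x := by
  induction k generalizing x with
  | zero => simp [TimesDifferentiableAt]
  | succ k ih =>
    have : iteratedDeriv k (fun y => -f y) = fun y => -iteratedDeriv k f y := by
      ext y; exact iteratedDeriv_fun_neg k f y
    rw [TimesDifferentiableAt, TimesDifferentiableAt, this]
    simp_rw [ih, differentiableAt_fun_neg_iff]

/-- The second-order difference quotient at `0` of an even twice differentiable function. -/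
lemma tendsto_even_difference_quotient {f : ℝ → ℝ} (heven : ∀ x, f (-x) = f x)
    (hf : TimesDifferentiableAt 2 f 0) :
    Tendsto (fun t => (f t - f 0) / t ^ 2) (𝓝[>] 0) (𝓝 (deriv (deriv f) 0 / 2)) := by
  have hd : ∀ᶠ y in 𝓝 (0 : ℝ), DifferentiableAt ℝ f y := by
    filter_upwards [hf.1] with y hy
    simpa [TimesDifferentiableAt] using hy
  have hdd : DifferentiableAt ℝ (deriv f) 0 := by simpa using hf.2
  have hd0 : deriv f 0 = 0 := by
    have := deriv_comp_neg f 0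
    simp only [heven, neg_zero] at this
    linarith
  have hmono : 𝓝[>] (0 : ℝ) ≤ 𝓝 0 := nhdsWithin_le_nhds
  -- One use of L'Hôpital leaves `f'(t) / (2t)`. As `f'(0) = 0` by evenness, its limit is the
  -- derivative of `f'` at 0 over 2; continuity of the second derivative is not needed.
  refine HasDerivAt.lhopital_zero_nhdsGT (f' := deriv f) (g' := fun t => 2 * t) ?_ ?_ ?_ ?_ ?_ ?_
  · filter_upwards [hmono hd] with y hy using hy.hasDerivAt.sub_const _
  · exact Eventually.of_forall fun y => by simpa using hasDerivAt_pow 2 y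
  · filter_upwards [self_mem_nhdsWithin] with y hy
    exact mul_ne_zero two_ne_zero (ne_of_gt hy)
  · have : Tendsto (fun t => f t - f 0) (𝓝 0) (𝓝 (f 0 - f 0)) :=
      (hd.self_of_nhds.continuousAt.tendsto).sub_const _
    simpa using this.mono_left hmono
  · have : Tendsto (fun t : ℝ => t ^ 2) (𝓝 0) (𝓝 (0 ^ 2)) := (continuous_pow 2).tendsto 0
    simpa using this.mono_left hmono
  · have h1 := (hdd.hasDerivAt.tendsto_slope_zero_right).div_const 2
    refine h1.congr fun t => ?_
    simp [hd0]
    ring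

section CosineTransform

variable {Θ : Type*} [MeasurableSpace Θ] {μ : Measure Θ} {q T : Θ → ℝ}

/-- The integral of `q (2 - 2 cos(tT)) / t²` equals `-2 (f(t) - f(0)) / t²`, which converges, so the
Fatou bound applies. -/
lemma integrable_mul_sq_of_timesDifferentiableAt_two (hq : Measurable q) (hq0 : 0 ≤ q)
    (hT : Measurable T) (hqi : Integrable q μ)
    (h : TimesDifferentiableAt 2 (fun h => ∫ θ, q θ * cos (h * T θ) ∂μ) 0) :
    Integrable (fun θ => q θ * T θ ^ 2) μ := by
  set f : ℝ → ℝ := fun h => ∫ θ, q θ * cos (h * T θ) ∂μ with hf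
  have hlim := tendsto_even_difference_quotient (f := f) (fun x => by simp [hf]) h
  have ht : Tendsto (fun n : ℕ => 1 / ((n : ℝ) + 1)) atTop (𝓝[>] 0) :=
    tendsto_nhdsWithin_iff.2 ⟨tendsto_one_div_add_atTop_nhds_zero_nat,
      Eventually.of_forall fun n => by simp; positivity⟩
  have hlim2 := (hlim.comp ht).const_mul (-2)
  have hb := hlim2.eventually_le_const (lt_add_one _)
  refine integrable_mul_sq_of_bounded hq hq0 hT hqi
    (B := -2 * (deriv (deriv f) 0 / 2) + 1) (ht.mono_right (nhdsWithin_mono _ fun x hx => ne_of_gt hx)) (hb.mono fun n hn => ?_)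
  refine le_trans (le_of_eq ?_) hn
  have hi : ∀ h, Integrable (fun θ => q θ * cos (h * T θ)) μ := fun h =>
    hqi.mul_bdd (c := 1) (by fun_prop) (Eventually.of_forall fun θ => abs_cos_le_one _)
  simp only [Function.comp, hf]
  rw [← integral_sub (hi _) (hi _), ← integral_div, ← integral_const_mul]
  congr 1 with θ
  simp
  ring

/-- The cosine transform of a nonnegative integrable weight is `2 m` times differentiable at `0`
if and only if the weight has a moment of order `2 m`. -/
theorem timesDifferentiableAt_integral_cos_iff (hT : Measurable T) (m : ℕ) (hq : Measurable q)
    (hq0 : 0 ≤ q) (hqi : Integrable q μ) :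
    TimesDifferentiableAt (2 * m) (fun h => ∫ θ, q θ * cos (h * T θ) ∂μ) 0 ↔
      Integrable (fun θ => q θ * T θ ^ (2 * m)) μ := by
  induction m generalizing q with
  | zero => simpa [TimesDifferentiableAt] using hqi
  | succ m ih =>
    -- Given a second moment, two differentiations under the integral turn the transform of `q` into
    -- minus that of `q T²`, to which the induction hypothesis applies. Each direction of the
    -- equivalence then only has to supply this second moment.
    have key : Integrable (fun θ => q θ * T θ ^ 2) μ →
        (TimesDifferentiableAt (2 * (m + 1)) (fun h => ∫ θ, q θ * cos (h * T θ) ∂μ) 0 ↔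
          Integrable (fun θ => q θ * T θ ^ (2 * (m + 1))) μ) := by
      intro h2
      have h1 := integrable_mul_self_of_integrable_mul_sq hq hT hqi h2
      have d1 := hasDerivAt_integral_cos hq hT hqi h1
      have d2 := hasDerivAt_integral_sin (q := fun θ => q θ * T θ) (by fun_prop) hT h1
        (by simpa [mul_assoc, sq] using h2)
      have e1 : deriv (fun h => ∫ θ, q θ * cos (h * T θ) ∂μ) =
          fun h => -∫ θ, q θ * T θ * sin (h * T θ) ∂μ := by
        ext h; rw [(d1 h).deriv, integral_neg]
      have e2 : deriv (fun h => ∫ θ, q θ * T θ * sin (h * T θ) ∂μ) =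
          fun h => ∫ θ, q θ * T θ ^ 2 * cos (h * T θ) ∂μ := by
        ext h; rw [(d2 h).deriv]; simp only [sq, mul_assoc]
      rw [show 2 * (m + 1) = 2 * m + 1 + 1 by ring,
        timesDifferentiableAt_succ_iff_deriv fun h => (d1 h).differentiableAt, e1,
        timesDifferentiableAt_neg_iff,
        timesDifferentiableAt_succ_iff_deriv fun h => (d2 h).differentiableAt, e2,
        ih (q := fun θ => q θ * T θ ^ 2) (by fun_prop)
          (fun θ => mul_nonneg (hq0 θ) (sq_nonneg _)) h2]
      rw [iff_iff_eq]
      congr 1 with θ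
      ring
    refine ⟨fun h => (key ?_).1 h, fun h => (key ?_).2 h⟩
    · exact integrable_mul_sq_of_timesDifferentiableAt_two hq hq0 hT hqi (h.of_le (by omega))
    · refine (hqi.add h).mono' (by fun_prop) (Eventually.of_forall fun θ => ?_)
      have hp : T θ ^ 2 ≤ 1 + T θ ^ (2 * (m + 1)) := by
        rw [pow_mul]
        rcases le_total (T θ ^ 2) 1 with h | h
        · have := pow_nonneg (sq_nonneg (T θ)) (m + 1); linarith
        · have := le_self_pow₀ h (Nat.succ_ne_zero m); simp at this; linarith
      rw [Real.norm_of_nonneg (mul_nonneg (hq0 θ) (sq_nonneg _))]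
      have := mul_le_mul_of_nonneg_left hp (hq0 θ)
      simp only [Pi.add_apply]; linarith

end CosineTransform

/-! ### Directional derivatives of Hilbert-valued fields with a spectral representation -/

section DifferenceKernel

/-- The real part of the product of `exp(i c)`, `(exp(i a x) - 1) / a` and the conjugate of
`(exp(i b x) - 1) / b`. -/
noncomputable def cosDifferenceKernel (a b x c : ℝ) : ℝ :=
  (Complex.exp (Complex.I * c) * ((Complex.exp (Complex.I * (a * x : ℝ)) - 1) / a) *
    ((Complex.exp (Complex.I * (-(b * x) : ℝ)) - 1) / b)).re

/-- The four cosines come from expanding an inner product of two difference quotients; the product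
of exponentials gives bound and limit factor by factor. -/
lemma cosDifferenceKernel_eq (a b x c : ℝ) :
    cosDifferenceKernel a b x c = a⁻¹ * b⁻¹ *
      (cos (c + a * x - b * x) - cos (c + a * x) - cos (c - b * x) + cos c) := by
  have h : Complex.exp (Complex.I * c) * ((Complex.exp (Complex.I * (a * x : ℝ)) - 1) / a) *
      ((Complex.exp (Complex.I * (-(b * x) : ℝ)) - 1) / b) =
      ((a⁻¹ * b⁻¹ : ℝ) : ℂ) * (Complex.exp ((c + a * x - b * x : ℝ) * Complex.I)
        - Complex.exp ((c + a * x : ℝ) * Complex.I) - Complex.exp ((c - b * x : ℝ) * Complex.I)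
        + Complex.exp ((c : ℝ) * Complex.I)) := by
    rw [show ((c + a * x - b * x : ℝ) * Complex.I : ℂ) = Complex.I * c + Complex.I * (a * x : ℝ) +
        Complex.I * (-(b * x) : ℝ) by push_cast; ring,
      show ((c + a * x : ℝ) * Complex.I : ℂ) = Complex.I * c + Complex.I * (a * x : ℝ) by
        push_cast; ring,
      show ((c - b * x : ℝ) * Complex.I : ℂ) = Complex.I * c + Complex.I * (-(b * x) : ℝ) by
        push_cast; ring, mul_comm (c : ℂ) Complex.I]
    simp only [Complex.exp_add, Complex.ofReal_mul, Complex.ofReal_inv]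
    ring
  rw [cosDifferenceKernel, h, Complex.re_ofReal_mul]
  simp only [Complex.add_re, Complex.sub_re, Complex.exp_ofReal_mul_I_re]

/-- Each quotient is at most `|x|` because `|exp(iy) - 1| ≤ |y|`; at increment 0, division by zero
makes it 0. -/
lemma abs_cosDifferenceKernel_le (a b x c : ℝ) : |cosDifferenceKernel a b x c| ≤ x ^ 2 := by
  have key : ∀ a x : ℝ, ‖(Complex.exp (Complex.I * (a * x : ℝ)) - 1) / (a : ℂ)‖ ≤ |x| := by
    intro a x
    rcases eq_or_ne a 0 with rfl | ha
    · simp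
    rw [norm_div, Complex.norm_real, Real.norm_eq_abs, div_le_iff₀ (abs_pos.2 ha)]
    refine (Real.norm_exp_I_mul_ofReal_sub_one_le).trans_eq ?_
    rw [Real.norm_eq_abs, abs_mul, mul_comm]
  refine (Complex.abs_re_le_norm _).trans ?_
  rw [norm_mul, norm_mul, mul_comm Complex.I (c : ℂ), Complex.norm_exp_ofReal_mul_I, one_mul,
    ← sq_abs, sq]
  refine mul_le_mul (key a x) ?_ (norm_nonneg _) (abs_nonneg _)
  have := key b (-x)
  rwa [abs_neg, mul_neg] at this

/-- The two quotients tend to `ix` and `-ix`. The increments vary independently, as the Cauchy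
criterion requires. -/
lemma tendsto_cosDifferenceKernel (x c : ℝ) :
    Tendsto (fun p : ℝ × ℝ => cosDifferenceKernel p.1 p.2 x c) (𝓝[≠] 0 ×ˢ 𝓝[≠] 0)
      (𝓝 (x ^ 2 * cos c)) := by
  have key : ∀ x : ℝ, Tendsto (fun a : ℝ => (Complex.exp (Complex.I * (a * x : ℝ)) - 1) / (a : ℂ))
      (𝓝[≠] 0) (𝓝 (Complex.I * x)) := by
    intro x
    have h : HasDerivAt (fun a : ℝ => Complex.exp (Complex.I * (a * x : ℝ))) (Complex.I * x) 0 := by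
      have h1 : HasDerivAt (fun a : ℝ => Complex.I * (a * x : ℝ)) (Complex.I * x) 0 := by
        have := ((hasDerivAt_id (0 : ℝ)).mul_const x).ofReal_comp.const_mul Complex.I
        simpa using this
      simpa using h1.cexp
    refine h.tendsto_slope_zero.congr fun a => ?_
    rw [Complex.real_smul]
    simp [div_eq_inv_mul]
  have h := ((key x).comp (tendsto_fst (g := 𝓝[≠] (0 : ℝ)))).mul
    ((key (-x)).comp (tendsto_snd (f := 𝓝[≠] (0 : ℝ))))
  have h2 := (h.const_mul (Complex.exp (Complex.I * c)))
  have h3 := (Complex.continuous_re.tendsto _).comp h2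
  convert! h3 using 2
  · simp only [cosDifferenceKernel, Function.comp, mul_neg, mul_assoc]
  · have : Complex.exp (Complex.I * c) * (Complex.I * x * (Complex.I * (-x : ℝ))) =
        ((x ^ 2 : ℝ) : ℂ) * Complex.exp ((c : ℝ) * Complex.I) := by
      rw [mul_comm (c : ℂ) Complex.I]
      push_cast
      linear_combination (-(Complex.exp (Complex.I * c)) * x ^ 2) * Complex.I_sq
    rw [this, Complex.re_ofReal_mul, Complex.exp_ofReal_mul_I_re]

lemma cosDifferenceKernel_self_zero (a x : ℝ) :
    cosDifferenceKernel a a x 0 = (2 - 2 * cos (a * x)) / a ^ 2 := by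
  rw [cosDifferenceKernel_eq]
  simp only [zero_add, sub_self, cos_zero, zero_sub, cos_neg]
  ring

@[fun_prop]
lemma measurable_cosDifferenceKernel {Θ : Type*} [MeasurableSpace Θ] (a b : ℝ) {x c : Θ → ℝ}
    (hx : Measurable x) (hc : Measurable c) :
    Measurable fun θ => cosDifferenceKernel a b (x θ) (c θ) := by
  simp only [cosDifferenceKernel_eq]
  fun_prop

end DifferenceKernel

section HilbertField

variable {Θ : Type*} [MeasurableSpace Θ] {μ : Measure Θ} {q : Θ → ℝ}
  {E : Type*} [NormedAddCommGroup E] [InnerProductSpace ℝ E] [MeasurableSpace E] [BorelSpace E]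
  [SecondCountableTopology E] {T : Θ → E}
  {H : Type*} [NormedAddCommGroup H] [InnerProductSpace ℝ H] {V : E → H} {k : ℝ} {u : E}

lemma integrable_mul_cos (hqi : Integrable q μ) {c : Θ → ℝ} (hc : Measurable c) :
    Integrable (fun θ => q θ * cos (c θ)) μ :=
  hqi.mul_bdd (c := 1) (by fun_prop) (Eventually.of_forall fun θ => abs_cos_le_one _)

lemma integral_sub_sub_add {f₁ f₂ f₃ f₄ : Θ → ℝ} (h₁ : Integrable f₁ μ) (h₂ : Integrable f₂ μ)
    (h₃ : Integrable f₃ μ) (h₄ : Integrable f₄ μ) :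
    ∫ θ, (f₁ θ - f₂ θ - f₃ θ + f₄ θ) ∂μ =
      ∫ θ, f₁ θ ∂μ - ∫ θ, f₂ θ ∂μ - ∫ θ, f₃ θ ∂μ + ∫ θ, f₄ θ ∂μ := by
  rw [integral_add (f := fun θ => f₁ θ - f₂ θ - f₃ θ) ((h₁.sub h₂).sub h₃) h₄,
    integral_sub (f := fun θ => f₁ θ - f₂ θ) (h₁.sub h₂) h₃, integral_sub h₁ h₂]

/-- The Gram function of the difference quotients of a field with a spectral representation. -/
lemma inner_difference_quotient (hT : Measurable T) (hqi : Integrable q μ)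
    (hV : ∀ s t, inner ℝ (V s) (V t) = k + ∫ θ, q θ * cos (inner ℝ (s - t) (T θ)) ∂μ)
    (s t u : E) (a b : ℝ) :
    inner ℝ (a⁻¹ • (V (s + a • u) - V s)) (b⁻¹ • (V (t + b • u) - V t)) =
      ∫ θ, q θ * cosDifferenceKernel a b (inner ℝ u (T θ)) (inner ℝ (s - t) (T θ)) ∂μ := by
  have hi : ∀ v : E, Integrable (fun θ => q θ * cos (inner ℝ v (T θ))) μ := fun v =>
    integrable_mul_cos hqi (by fun_prop)
  rw [real_inner_smul_left, real_inner_smul_right, inner_sub_left, inner_sub_right,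
    inner_sub_right, hV, hV, hV, hV]
  -- The constant `k` cancels in the double difference.
  have e : a⁻¹ * (b⁻¹ *
      (k + ∫ θ, q θ * cos (inner ℝ (s + a • u - (t + b • u)) (T θ)) ∂μ -
        (k + ∫ θ, q θ * cos (inner ℝ (s + a • u - t) (T θ)) ∂μ) -
        (k + ∫ θ, q θ * cos (inner ℝ (s - (t + b • u)) (T θ)) ∂μ -
          (k + ∫ θ, q θ * cos (inner ℝ (s - t) (T θ)) ∂μ)))) =
      a⁻¹ * b⁻¹ *
      (∫ θ, q θ * cos (inner ℝ (s + a • u - (t + b • u)) (T θ)) ∂μ -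
        ∫ θ, q θ * cos (inner ℝ (s + a • u - t) (T θ)) ∂μ -
        ∫ θ, q θ * cos (inner ℝ (s - (t + b • u)) (T θ)) ∂μ +
        ∫ θ, q θ * cos (inner ℝ (s - t) (T θ)) ∂μ) := by ring
  have hk : ∀ θ, q θ * cosDifferenceKernel a b (inner ℝ u (T θ)) (inner ℝ (s - t) (T θ)) =
      a⁻¹ * b⁻¹ * (q θ * cos (inner ℝ (s + a • u - (t + b • u)) (T θ)) -
        q θ * cos (inner ℝ (s + a • u - t) (T θ)) - q θ * cos (inner ℝ (s - (t + b • u)) (T θ)) +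
        q θ * cos (inner ℝ (s - t) (T θ))) := by
    intro θ
    rw [cosDifferenceKernel_eq,
      show s + a • u - (t + b • u) = (s - t) + a • u - b • u by abel,
      show s + a • u - t = (s - t) + a • u by abel,
      show s - (t + b • u) = (s - t) - b • u by abel]
    simp only [inner_add_left, inner_sub_left, real_inner_smul_left]
    ring
  simp only [e, hk]
  rw [integral_const_mul, integral_sub_sub_add (hi _) (hi _) (hi _) (hi _)]

lemma tendsto_inner_difference_quotient (hT : Measurable T) (hq : Measurable q)
    (hqi : Integrable q μ) (h2 : Integrable (fun θ => q θ * inner ℝ u (T θ) ^ 2) μ)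
    (hV : ∀ s t, inner ℝ (V s) (V t) = k + ∫ θ, q θ * cos (inner ℝ (s - t) (T θ)) ∂μ) (s t : E) :
    Tendsto (fun p : ℝ × ℝ =>
        inner ℝ (p.1⁻¹ • (V (s + p.1 • u) - V s)) (p.2⁻¹ • (V (t + p.2 • u) - V t)))
      (𝓝[≠] 0 ×ˢ 𝓝[≠] 0)
      (𝓝 (∫ θ, q θ * inner ℝ u (T θ) ^ 2 * cos (inner ℝ (s - t) (T θ)) ∂μ)) := by
  simp only [inner_difference_quotient hT hqi hV]
  refine tendsto_integral_filter_of_dominated_convergence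
    (fun θ => ‖q θ * inner ℝ u (T θ) ^ 2‖) (Eventually.of_forall fun p => by fun_prop)
    (Eventually.of_forall fun p => Eventually.of_forall fun θ => ?_) h2.norm
    (Eventually.of_forall fun θ => ?_)
  · rw [norm_mul, norm_mul, norm_pow, Real.norm_eq_abs (cosDifferenceKernel _ _ _ _),
      Real.norm_eq_abs (inner ℝ u (T θ)), sq_abs]
    exact mul_le_mul_of_nonneg_left (abs_cosDifferenceKernel_le _ _ _ _) (norm_nonneg _)
  · simp only [mul_assoc]
    exact (tendsto_cosDifferenceKernel _ _).const_mul _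

/-- A field with a spectral representation has a derivative in the direction `u` as soon as the
spectral weight has a second moment in that direction. -/
theorem exists_tendsto_difference_quotient [CompleteSpace H] (hT : Measurable T)
    (hq : Measurable q) (hqi : Integrable q μ)
    (h2 : Integrable (fun θ => q θ * inner ℝ u (T θ) ^ 2) μ)
    (hV : ∀ s t, inner ℝ (V s) (V t) = k + ∫ θ, q θ * cos (inner ℝ (s - t) (T θ)) ∂μ) (s : E) :
    ∃ w, Tendsto (fun a : ℝ => a⁻¹ • (V (s + a • u) - V s)) (𝓝[≠] 0) (𝓝 w) := by
  set A : ℝ → H := fun a => a⁻¹ • (V (s + a • u) - V s) with hA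
  have hlim := tendsto_inner_difference_quotient hT hq hqi h2 hV s s
  set L : ℝ := ∫ θ, q θ * inner ℝ u (T θ) ^ 2 * cos (inner ℝ (s - s) (T θ)) ∂μ
  -- Loève's criterion: all inner products of quotients share the limit `L`, so `‖A a - A b‖²` tends
  -- to `L - 2L + L = 0`.
  refine cauchy_map_iff_exists_tendsto.1 (cauchy_map_iff.2 ⟨inferInstance, ?_⟩)
  rw [tendsto_uniformity_iff_dist_tendsto_zero]
  have h11 : Tendsto (fun p : ℝ × ℝ => inner ℝ (A p.1) (A p.1)) (𝓝[≠] 0 ×ˢ 𝓝[≠] 0) (𝓝 L) :=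
    hlim.comp (tendsto_fst.prodMk tendsto_fst)
  have h22 : Tendsto (fun p : ℝ × ℝ => inner ℝ (A p.2) (A p.2)) (𝓝[≠] 0 ×ˢ 𝓝[≠] 0) (𝓝 L) :=
    hlim.comp (tendsto_snd.prodMk tendsto_snd)
  have hsq := ((h11.sub (hlim.const_mul 2)).add h22).sqrt
  rw [show L - 2 * L + L = 0 by ring, sqrt_zero] at hsq
  refine hsq.congr fun p => ?_
  rw [dist_eq_norm, ← sqrt_sq (norm_nonneg (A p.1 - A p.2)), norm_sub_sq_real,
    real_inner_self_eq_norm_sq, real_inner_self_eq_norm_sq]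

/-- If a field with a spectral representation has a derivative in the direction `u`, then the
spectral weight has a second moment in that direction. -/
theorem integrable_of_tendsto_difference_quotient (hT : Measurable T) (hq : Measurable q)
    (hq0 : 0 ≤ q) (hqi : Integrable q μ)
    (hV : ∀ s t, inner ℝ (V s) (V t) = k + ∫ θ, q θ * cos (inner ℝ (s - t) (T θ)) ∂μ) {s : E}
    {w : H} (hw : Tendsto (fun a : ℝ => a⁻¹ • (V (s + a • u) - V s)) (𝓝[≠] 0) (𝓝 w)) :
    Integrable (fun θ => q θ * inner ℝ u (T θ) ^ 2) μ := by
  have ht : Tendsto (fun n : ℕ => 1 / ((n : ℝ) + 1)) atTop (𝓝[≠] 0) :=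
    tendsto_nhdsWithin_iff.2 ⟨tendsto_one_div_add_atTop_nhds_zero_nat,
      Eventually.of_forall fun n => by simp; positivity⟩
  -- Convergent quotients have bounded squared norms, and these are the integrals in
  -- `integrable_mul_sq_of_bounded`.
  have hlim := (hw.comp ht).inner (𝕜 := ℝ) (hw.comp ht)
  have hb := hlim.eventually_le_const (lt_add_one _)
  refine integrable_mul_sq_of_bounded hq hq0 (by fun_prop) hqi ht
    (B := inner ℝ w w + 1) (hb.mono fun n hn => ?_)
  refine le_trans (le_of_eq ?_) hn
  simp only [Function.comp, inner_difference_quotient hT hqi hV, sub_self, inner_zero_left,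
    cosDifferenceKernel_self_zero]

/-- The spectral representation of the derivative in the direction `u`. -/
theorem inner_derivative_eq (hT : Measurable T) (hq : Measurable q) (hqi : Integrable q μ)
    (h2 : Integrable (fun θ => q θ * inner ℝ u (T θ) ^ 2) μ)
    (hV : ∀ s t, inner ℝ (V s) (V t) = k + ∫ θ, q θ * cos (inner ℝ (s - t) (T θ)) ∂μ) {W : E → H}
    (hW : ∀ s, Tendsto (fun a : ℝ => a⁻¹ • (V (s + a • u) - V s)) (𝓝[≠] 0) (𝓝 (W s))) (s t : E) :
    inner ℝ (W s) (W t) = ∫ θ, q θ * inner ℝ u (T θ) ^ 2 * cos (inner ℝ (s - t) (T θ)) ∂μ :=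
  tendsto_nhds_unique ((hW s).inner (hW t))
    ((tendsto_inner_difference_quotient hT hq hqi h2 hV s t).comp (tendsto_id.prodMk tendsto_id))

end HilbertField

/-! ### Mean-square differentiability of fields with a spectral representation -/

section RandomField

variable {d : ℕ} {Ω : Type u} [MeasurableSpace Ω] {P : Measure Ω}
  {Z Z' : EuclideanSpace ℝ (Fin d) → Ω → ℝ} {u : EuclideanSpace ℝ (Fin d)}
  {Θ : Type*} [MeasurableSpace Θ] {μ : Measure Θ} {q : Θ → ℝ} {T : Θ → EuclideanSpace ℝ (Fin d)}

/-- Up to an additive constant, the second moments of `Z` are the cosine transform of the image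
under `T` of the measure with density `q`. -/
def HasSpectralMoments (P : Measure Ω) (Z : EuclideanSpace ℝ (Fin d) → Ω → ℝ) (μ : Measure Θ)
    (q : Θ → ℝ) (T : Θ → EuclideanSpace ℝ (Fin d)) : Prop :=
  ∃ k : ℝ, ∀ s t, ∫ ω, Z s ω * Z t ω ∂P = k + ∫ θ, q θ * cos (inner ℝ (s - t) (T θ)) ∂μ

lemma inner_toLp_eq_integral {f g : Ω → ℝ} (hf : MemLp f 2 P) (hg : MemLp g 2 P) :
    inner ℝ (hf.toLp f) (hg.toLp g) = ∫ ω, f ω * g ω ∂P := by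
  rw [L2.inner_def]
  refine integral_congr_ae ?_
  filter_upwards [hf.coeFn_toLp, hg.coeFn_toLp] with ω h1 h2
  rw [h1, h2]
  simp [mul_comm]

lemma hasMSDerivAlong_iff_tendsto (hZ : ∀ s, MemLp (Z s) 2 P) (hZ' : ∀ s, MemLp (Z' s) 2 P) :
    HasMSDerivAlong P Z Z' u ↔ ∀ s, Tendsto
      (fun a : ℝ => a⁻¹ • ((hZ (s + a • u)).toLp (Z (s + a • u)) - (hZ s).toLp (Z s)))
      (𝓝[≠] 0) (𝓝 ((hZ' s).toLp (Z' s))) := by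
  refine forall_congr' fun s => ?_
  have hf : ∀ a : ℝ, MemLp (a⁻¹ • (Z (s + a • u) - Z s)) 2 P := fun a =>
    ((hZ (s + a • u)).sub (hZ s)).const_smul a⁻¹
  have h := Lp.tendsto_Lp_iff_tendsto_eLpNorm'' (fi := 𝓝[≠] (0 : ℝ)) _ hf (Z' s) (hZ' s)
  have e1 : ∀ a : ℝ, (hf a).toLp (a⁻¹ • (Z (s + a • u) - Z s)) =
      a⁻¹ • ((hZ (s + a • u)).toLp (Z (s + a • u)) - (hZ s).toLp (Z s)) := fun a => by
    rw [← MemLp.toLp_sub, ← MemLp.toLp_const_smul]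
  simp only [e1] at h
  rw [h]
  refine tendsto_congr fun a => ?_
  congr 1 with ω
  simp [div_eq_inv_mul]

lemma HasSpectralMoments.inner_eq {k : ℝ}
    (h : ∀ s t, ∫ ω, Z s ω * Z t ω ∂P = k + ∫ θ, q θ * cos (inner ℝ (s - t) (T θ)) ∂μ)
    (hZ : ∀ s, MemLp (Z s) 2 P) (s t : EuclideanSpace ℝ (Fin d)) :
    inner ℝ ((hZ s).toLp (Z s)) ((hZ t).toLp (Z t)) =
      k + ∫ θ, q θ * cos (inner ℝ (s - t) (T θ)) ∂μ := by
  rw [inner_toLp_eq_integral, h]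

/-- The mean-square derivative of a field with spectral moments, if it exists, has spectral
moments, with the weight multiplied by the square of the directional frequency. -/
lemma HasSpectralMoments.deriv (h : HasSpectralMoments P Z μ q T) (hT : Measurable T)
    (hq : Measurable q) (hq0 : 0 ≤ q) (hqi : Integrable q μ) (hZ : ∀ s, MemLp (Z s) 2 P)
    (hZ' : ∀ s, MemLp (Z' s) 2 P) (hd : HasMSDerivAlong P Z Z' u) :
    Integrable (fun θ => q θ * inner ℝ u (T θ) ^ 2) μ ∧
      HasSpectralMoments P Z' μ (fun θ => q θ * inner ℝ u (T θ) ^ 2) T := by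
  obtain ⟨k, hk⟩ := h
  have hV := HasSpectralMoments.inner_eq hk hZ
  have hW := (hasMSDerivAlong_iff_tendsto hZ hZ').1 hd
  have h2 := integrable_of_tendsto_difference_quotient (u := u) hT hq hq0 hqi hV (hW 0)
  refine ⟨h2, 0, fun s t => ?_⟩
  rw [zero_add, ← inner_derivative_eq hT hq hqi h2 hV hW s t, inner_toLp_eq_integral]

/-- The limits exist by completeness of L²; a representative chosen at each point gives the
derivative field. -/
lemma HasSpectralMoments.exists_deriv (h : HasSpectralMoments P Z μ q T) (hT : Measurable T)
    (hq : Measurable q) (hqi : Integrable q μ) (hZ : ∀ s, MemLp (Z s) 2 P)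
    (h2 : Integrable (fun θ => q θ * inner ℝ u (T θ) ^ 2) μ) :
    ∃ Z' : EuclideanSpace ℝ (Fin d) → Ω → ℝ, (∀ s, MemLp (Z' s) 2 P) ∧
      HasMSDerivAlong P Z Z' u := by
  obtain ⟨k, hk⟩ := h
  choose W hW using exists_tendsto_difference_quotient (u := u) hT hq hqi h2
    (HasSpectralMoments.inner_eq hk hZ)
  refine ⟨fun s => W s, fun s => Lp.memLp (W s), ?_⟩
  rw [hasMSDerivAlong_iff_tendsto hZ fun s => Lp.memLp (W s)]
  simpa only [Lp.toLp_coeFn] using hW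

/-- By Cauchy–Schwarz the radial moment controls every choice of directions: the new weight `q ⟨u,
T⟩²` keeps a radial moment of order `2m`. -/
theorem HasSpectralMoments.isMSDifferentiable (m : ℕ) (h : HasSpectralMoments P Z μ q T)
    (hT : Measurable T) (hq : Measurable q) (hq0 : 0 ≤ q) (hqi : Integrable q μ)
    (hZ : ∀ s, MemLp (Z s) 2 P) (hm : Integrable (fun θ => q θ * ‖T θ‖ ^ (2 * m)) μ) :
    IsMSDifferentiable P m Z := by
  induction m generalizing q Z with
  | zero => exact hZ
  | succ m ih =>
    refine ⟨hZ, fun u => ?_⟩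
    have hle : ∀ θ, inner ℝ u (T θ) ^ 2 ≤ ‖u‖ ^ 2 * ‖T θ‖ ^ 2 := fun θ => by
      rw [← mul_pow, ← sq_abs]
      exact pow_le_pow_left₀ (abs_nonneg _) (abs_real_inner_le_norm _ _) 2
    have hm2 : Integrable (fun θ => q θ * inner ℝ u (T θ) ^ 2 * ‖T θ‖ ^ (2 * m)) μ := by
      refine (hm.const_mul (‖u‖ ^ 2)).mono' (by fun_prop) (Eventually.of_forall fun θ => ?_)
      have h0 : 0 ≤ q θ * inner ℝ u (T θ) ^ 2 * ‖T θ‖ ^ (2 * m) :=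
        mul_nonneg (mul_nonneg (hq0 θ) (sq_nonneg _)) (by positivity)
      rw [Real.norm_of_nonneg h0]
      calc q θ * inner ℝ u (T θ) ^ 2 * ‖T θ‖ ^ (2 * m)
          ≤ q θ * (‖u‖ ^ 2 * ‖T θ‖ ^ 2) * ‖T θ‖ ^ (2 * m) := by
            gcongr
            · exact hq0 θ
            · exact hle θ
        _ = ‖u‖ ^ 2 * (q θ * ‖T θ‖ ^ (2 * (m + 1))) := by ring
    have h2 : Integrable (fun θ => q θ * inner ℝ u (T θ) ^ 2) μ := by
      refine ((hqi.add hm).const_mul (‖u‖ ^ 2)).mono' (by fun_prop)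
        (Eventually.of_forall fun θ => ?_)
      have h0 : 0 ≤ q θ * inner ℝ u (T θ) ^ 2 := mul_nonneg (hq0 θ) (sq_nonneg _)
      have hp : ‖T θ‖ ^ 2 ≤ 1 + ‖T θ‖ ^ (2 * (m + 1)) := by
        rcases le_total ‖T θ‖ 1 with h | h
        · have := pow_le_one₀ (norm_nonneg (T θ)) h (n := 2)
          have := pow_nonneg (norm_nonneg (T θ)) (2 * (m + 1))
          linarith
        · have := pow_le_pow_right₀ h (show 2 ≤ 2 * (m + 1) by omega)
          linarith
      rw [Real.norm_of_nonneg h0, Pi.add_apply]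
      calc q θ * inner ℝ u (T θ) ^ 2 ≤ q θ * (‖u‖ ^ 2 * (1 + ‖T θ‖ ^ (2 * (m + 1)))) :=
            mul_le_mul_of_nonneg_left
              ((hle θ).trans (mul_le_mul_of_nonneg_left hp (sq_nonneg _))) (hq0 θ)
        _ = ‖u‖ ^ 2 * (q θ + q θ * ‖T θ‖ ^ (2 * (m + 1))) := by ring
    obtain ⟨Z', hZ', hd⟩ := h.exists_deriv hT hq hqi hZ h2
    exact ⟨Z', hd, ih (h.deriv hT hq hq0 hqi hZ hZ' hd).2 (by fun_prop)
      (fun θ => mul_nonneg (hq0 θ) (sq_nonneg _)) h2 hZ' hm2⟩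

lemma IsMSDifferentiableAlong.memLp {m : ℕ} (h : IsMSDifferentiableAlong P u m Z) :
    ∀ s, MemLp (Z s) 2 P := by
  cases m with
  | zero => exact h
  | succ m => exact h.1

/-- Each derivative that exists forces a second moment of the current weight and multiplies it by
`⟨u, T⟩²`. -/
theorem HasSpectralMoments.integrable_of_isMSDifferentiableAlong (m : ℕ)
    (h : HasSpectralMoments P Z μ q T) (hT : Measurable T) (hq : Measurable q) (hq0 : 0 ≤ q)
    (hqi : Integrable q μ) (hm : IsMSDifferentiableAlong P u m Z) :
    Integrable (fun θ => q θ * inner ℝ u (T θ) ^ (2 * m)) μ := by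
  induction m generalizing q Z with
  | zero => simpa using hqi
  | succ m ih =>
    obtain ⟨hZ, Z', hd, hm'⟩ := hm
    obtain ⟨h2, h'⟩ := h.deriv hT hq hq0 hqi hZ hm'.memLp hd
    refine (ih h' (by fun_prop) (fun θ => mul_nonneg (hq0 θ) (sq_nonneg _)) h2 hm').congr
      (Eventually.of_forall fun θ => ?_)
    simp only
    ring

lemma IsMSDifferentiable.along {m : ℕ} (h : IsMSDifferentiable P m Z)
    (u : EuclideanSpace ℝ (Fin d)) : IsMSDifferentiableAlong P u m Z := by
  induction m generalizing Z with
  | zero => exact h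
  | succ m ih =>
    obtain ⟨Z', hd, hm⟩ := h.2 u
    exact ⟨h.1, Z', hd, ih hm⟩

/-- Second moments are covariances plus the squared mean, which is the additive constant. -/
lemma IsIsotropicField.hasSpectralMoments [IsProbabilityMeasure P] {F : ℝ → ℝ}
    (h : IsIsotropicField P Z F)
    (hF : ∀ v : EuclideanSpace ℝ (Fin d), F ‖v‖ = ∫ θ, q θ * cos (inner ℝ v (T θ)) ∂μ) :
    HasSpectralMoments P Z μ q T := by
  obtain ⟨c, hc⟩ := h.mean
  refine ⟨c * c, fun s t => ?_⟩
  have := covariance_eq_sub (h.memLp s) (h.memLp t)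
  rw [h.cov, hc, hc, hF] at this
  simp only [Pi.mul_apply] at this
  linarith

end RandomField

/-! ### Scale mixtures of Gaussian covariances -/

section StdGaussian

variable {E : Type*} [NormedAddCommGroup E] [InnerProductSpace ℝ E] [FiniteDimensional ℝ E]
  [MeasurableSpace E] [BorelSpace E]

lemma integral_cos_inner_stdGaussian (v : E) :
    ∫ g, cos (inner ℝ v g) ∂(stdGaussian E) = exp (-‖v‖ ^ 2 / 2) := by
  have h := charFun_stdGaussian v
  rw [charFun_apply] at h
  have h2 := congrArg Complex.re h
  have hi : Integrable (fun g : E => Complex.exp (inner ℝ g v * Complex.I)) (stdGaussian E) := by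
    refine (integrable_const (1 : ℝ)).mono' (by fun_prop) (Eventually.of_forall fun g => ?_)
    rw [Complex.norm_exp_ofReal_mul_I]
  rw [← Complex.reCLM_apply, ← ContinuousLinearMap.integral_comp_comm _ hi] at h2
  simp only [Complex.reCLM_apply, Complex.exp_ofReal_mul_I_re] at h2
  simp only [real_inner_comm v] at h2
  rw [h2, show (-(‖v‖ : ℂ) ^ 2 / 2) = ((-‖v‖ ^ 2 / 2 : ℝ) : ℂ) by push_cast; rfl,
    Complex.exp_ofReal_re]

lemma integrable_norm_pow_stdGaussian (n : ℕ) :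
    Integrable (fun g : E => ‖g‖ ^ n) (stdGaussian E) := by
  have h := (IsGaussian.memLp_id (stdGaussian E) n (by simp)).integrable_norm_pow'
  simpa using h

/-- Otherwise `⟨u, g⟩ = 0` almost surely, and the characteristic function at `u` would be 1 instead
of `exp(-‖u‖² / 2)`. -/
lemma exists_inner_ne_zero_of_ae_stdGaussian {u : E} (hu : u ≠ 0) {p : E → Prop}
    (hp : ∀ᵐ g ∂(stdGaussian E), p g) : ∃ g, p g ∧ inner ℝ u g ≠ 0 := by
  by_contra! hcon
  have h1 : ∫ g, cos (inner ℝ u g) ∂(stdGaussian E) = ∫ _, 1 ∂(stdGaussian E) := by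
    refine integral_congr_ae ?_
    filter_upwards [hp] with g hg
    rw [hcon g hg, cos_zero]
  rw [integral_cos_inner_stdGaussian] at h1
  simp only [integral_const, probReal_univ, smul_eq_mul, mul_one, exp_eq_one_iff] at h1
  have : 0 < ‖u‖ ^ 2 := by positivity
  linarith

end StdGaussian

section GaussianMixture

variable {Λ : Type*} [MeasurableSpace Λ] {ρ : Measure Λ} {X : Λ → ℝ}
  {F : ℝ → ℝ} {σsq ν : ℝ} {E : Type*} [NormedAddCommGroup E] [InnerProductSpace ℝ E]
  [FiniteDimensional ℝ E] [MeasurableSpace E] [BorelSpace E]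

lemma integrable_gaussianMixture_norm (hX0 : ∀ l, 0 ≤ X l) {m : ℕ}
    (hm : Integrable (fun l => X l ^ m) ρ) :
    Integrable (fun θ : Λ × E => σsq * ‖√(2 * X θ.1) • θ.2‖ ^ (2 * m))
      (ρ.prod (stdGaussian E)) := by
  have h := ((hm.mul_prod (integrable_norm_pow_stdGaussian (E := E) (2 * m))).const_mul
    (σsq * 2 ^ m))
  refine h.congr (Eventually.of_forall fun θ => ?_)
  simp only [norm_smul, mul_pow, norm_of_nonneg (sqrt_nonneg _), pow_mul √_,
    sq_sqrt (mul_nonneg zero_le_two (hX0 _))]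
  ring

variable [IsFiniteMeasure ρ]

/-- Given `l`, the vector `√(2X) g` has characteristic function `exp(-X ‖v‖²)`. -/
lemma gaussianMixture_eq_integral_cos (hX : Measurable X) (hX0 : ∀ l, 0 ≤ X l)
    (hF : ∀ h, 0 ≤ h → F h = ∫ l, σsq * exp (-(X l * h ^ 2)) ∂ρ) (v : E) :
    F ‖v‖ = ∫ θ, σsq * cos (inner ℝ v (√(2 * X θ.1) • θ.2)) ∂(ρ.prod (stdGaussian E)) := by
  rw [hF _ (norm_nonneg v), integral_prod]
  · refine integral_congr_ae (Eventually.of_forall fun l => ?_)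
    simp only
    rw [integral_const_mul]
    congr 1
    have := integral_cos_inner_stdGaussian (√(2 * X l) • v)
    simp only [real_inner_smul_left] at this
    simp only [real_inner_smul_right]
    rw [this, norm_smul, mul_pow, norm_of_nonneg (sqrt_nonneg _),
      sq_sqrt (mul_nonneg zero_le_two (hX0 l))]
    congr 1
    ring
  · exact integrable_mul_cos (integrable_const _) (by fun_prop)

/-- By Fubini almost every slice in `g` is integrable, and a slice with `⟨u, g⟩ ≠ 0` is a nonzero
multiple of `X^m`. -/
lemma integrable_of_integrable_gaussianMixture_inner (hX0 : ∀ l, 0 ≤ X l)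
    (hσ : 0 < σsq) {m : ℕ} {u : E} (hu : u ≠ 0)
    (h : Integrable (fun θ : Λ × E => σsq * inner ℝ u (√(2 * X θ.1) • θ.2) ^ (2 * m))
      (ρ.prod (stdGaussian E))) :
    Integrable (fun l => X l ^ m) ρ := by
  obtain ⟨g, hg, hg0⟩ := exists_inner_ne_zero_of_ae_stdGaussian hu h.prod_left_ae
  have := hg.const_mul (σsq * 2 ^ m * inner ℝ u g ^ (2 * m))⁻¹
  refine this.congr (Eventually.of_forall fun l => ?_)
  simp only [real_inner_smul_right, mul_pow, pow_mul √_, sq_sqrt (mul_nonneg zero_le_two (hX0 _))]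
  field_simp

/-- For a scale mixture of Gaussian covariances whose mixing law has a finite moment of order `m`
exactly when `m < ν`, the parameter `ν` governs the differentiability at the origin. -/
theorem timesDifferentiableAt_gaussianMixture_iff (hX : Measurable X) (hX0 : ∀ l, 0 ≤ X l)
    (hF : ∀ h, 0 ≤ h → F h = ∫ l, σsq * exp (-(X l * h ^ 2)) ∂ρ) (hσ : 0 < σsq)
    (hm : ∀ m : ℕ, Integrable (fun l => X l ^ m) ρ ↔ (m : ℝ) < ν) (m : ℕ) :
    TimesDifferentiableAt (2 * m) (fun h => F |h|) 0 ↔ (m : ℝ) < ν := by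
  have e : (fun h => F |h|) = fun h : ℝ => ∫ θ : Λ × ℝ, σsq * cos (h * (√(2 * X θ.1) * θ.2))
      ∂(ρ.prod (stdGaussian ℝ)) := by
    ext h
    rw [← Real.norm_eq_abs, gaussianMixture_eq_integral_cos hX hX0 hF]
    simp [mul_comm]
  rw [e, timesDifferentiableAt_integral_cos_iff (q := fun _ => σsq)
    (T := fun θ : Λ × ℝ => √(2 * X θ.1) * θ.2) (by fun_prop) m (by fun_prop) (fun _ => hσ.le)
    (integrable_const _), ← hm]
  constructor
  · intro h
    refine integrable_of_integrable_gaussianMixture_inner hX0 hσ (one_ne_zero (α := ℝ)) ?_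
    simpa using h
  · intro h
    have := integrable_gaussianMixture_norm (E := ℝ) (σsq := σsq) hX0 h
    simpa only [norm_smul, Real.norm_eq_abs, ← abs_mul, (even_two_mul m).pow_abs] using this

variable {d : ℕ} {Ω : Type u} [MeasurableSpace Ω] {P : Measure Ω} [IsProbabilityMeasure P]
  {Z : EuclideanSpace ℝ (Fin d) → Ω → ℝ}

/-- Sufficiency yields all directions at once while necessity uses a single one, so both notions
have the same threshold. -/
theorem isMSDifferentiable_gaussianMixture_iff (hd : 0 < d) (hX : Measurable X)
    (hX0 : ∀ l, 0 ≤ X l)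
    (hF : ∀ h, 0 ≤ h → F h = ∫ l, σsq * exp (-(X l * h ^ 2)) ∂ρ) (hσ : 0 < σsq)
    (hm : ∀ m : ℕ, Integrable (fun l => X l ^ m) ρ ↔ (m : ℝ) < ν)
    (hZ : IsIsotropicField P Z F) :
    (∀ m : ℕ, IsMSDifferentiable P m Z ↔ (m : ℝ) < ν) ∧
      ∀ (m : ℕ) (e : EuclideanSpace ℝ (Fin d)), e ≠ 0 →
        (IsMSDifferentiableAlong P e m Z ↔ (m : ℝ) < ν) := by
  have hs := hZ.hasSpectralMoments (gaussianMixture_eq_integral_cos hX hX0 hF)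
  have hT : Measurable fun θ : Λ × EuclideanSpace ℝ (Fin d) => √(2 * X θ.1) • θ.2 := by fun_prop
  have suff : ∀ m : ℕ, (m : ℝ) < ν → IsMSDifferentiable P m Z := fun m hmν =>
    hs.isMSDifferentiable m hT measurable_const (fun _ => hσ.le) (integrable_const _) hZ.memLp
      (integrable_gaussianMixture_norm hX0 ((hm m).2 hmν))
  have nec : ∀ (m : ℕ) (e : EuclideanSpace ℝ (Fin d)), e ≠ 0 →
      IsMSDifferentiableAlong P e m Z → (m : ℝ) < ν := fun m e he h =>
    (hm m).1 (integrable_of_integrable_gaussianMixture_inner hX0 hσ he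
      (hs.integrable_of_isMSDifferentiableAlong m hT measurable_const (fun _ => hσ.le)
        (integrable_const _) h))
  have : Nonempty (Fin d) := ⟨⟨0, hd⟩⟩
  obtain ⟨e, he⟩ := exists_ne (0 : EuclideanSpace ℝ (Fin d))
  exact ⟨fun m => ⟨fun h => nec m e he (h.along e), suff m⟩,
    fun m e he => ⟨nec m e he, fun h => (suff m h).along e⟩⟩

end GaussianMixture

/-! ### Integration against gamma distributions -/

section GammaMeasure

variable {a r : ℝ}

lemma gammaMeasure_eq_withDensity_restrict (a r : ℝ) :
    gammaMeasure a r = (volume.restrict (Ioi 0)).withDensity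
      fun x => ENNReal.ofReal (r ^ a / Gamma a * x ^ (a - 1) * exp (-(r * x))) := by
  rw [gammaMeasure, ← withDensity_indicator measurableSet_Ioi]
  refine withDensity_congr_ae ?_
  filter_upwards [compl_mem_ae_iff.2 (measure_singleton (0 : ℝ))] with x hx
  rcases lt_or_gt_of_ne (show x ≠ 0 from hx) with h | h
  · rw [gammaPDF_of_neg h, indicator_of_notMem (by simpa using h.le)]
  · rw [gammaPDF_of_nonneg h.le, indicator_of_mem (by simpa using h)]

lemma gammaDensity_nonneg (ha : 0 < a) (hr : 0 < r) {x : ℝ} (hx : 0 < x) :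
    0 ≤ r ^ a / Gamma a * x ^ (a - 1) * exp (-(r * x)) := by
  have := Gamma_pos_of_pos ha
  positivity

lemma integral_gammaMeasure (ha : 0 < a) (hr : 0 < r) (f : ℝ → ℝ) :
    ∫ x, f x ∂(gammaMeasure a r) =
      ∫ x in Ioi 0, r ^ a / Gamma a * x ^ (a - 1) * exp (-(r * x)) * f x := by
  rw [gammaMeasure_eq_withDensity_restrict, integral_withDensity_eq_integral_toReal_smul
    (by fun_prop) (Eventually.of_forall fun x => ENNReal.ofReal_lt_top)]
  refine setIntegral_congr_fun measurableSet_Ioi fun x hx => ?_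
  rw [ENNReal.toReal_ofReal (gammaDensity_nonneg ha hr hx), smul_eq_mul]

lemma integrable_gammaMeasure_iff (ha : 0 < a) (hr : 0 < r) (f : ℝ → ℝ) :
    Integrable f (gammaMeasure a r) ↔
      IntegrableOn (fun x => r ^ a / Gamma a * x ^ (a - 1) * exp (-(r * x)) * f x) (Ioi 0) := by
  rw [gammaMeasure_eq_withDensity_restrict, integrable_withDensity_iff_integrable_smul'
    (by fun_prop) (Eventually.of_forall fun x => ENNReal.ofReal_lt_top), IntegrableOn]
  refine integrable_congr ?_
  filter_upwards [ae_restrict_mem measurableSet_Ioi] with x hx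
  rw [ENNReal.toReal_ofReal (gammaDensity_nonneg ha hr hx), smul_eq_mul]

lemma ae_pos_gammaMeasure (a r : ℝ) : ∀ᵐ x ∂(gammaMeasure a r), 0 < x := by
  rw [gammaMeasure_eq_withDensity_restrict]
  exact (withDensity_absolutelyContinuous _ _).ae_le (ae_restrict_mem measurableSet_Ioi)

/-- The gamma distribution has finite moments of every order `p` with `a + p > 0`. -/
lemma integrable_rpow_gammaMeasure (ha : 0 < a) (hr : 0 < r) {p : ℝ} (hp : 0 < a + p) :
    Integrable (fun x => x ^ p) (gammaMeasure a r) := by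
  rw [integrable_gammaMeasure_iff ha hr]
  have h := (integrableOn_rpow_mul_exp_neg_mul_rpow (s := a + p - 1) (p := 1) (b := r)
    (by linarith) zero_lt_one hr).const_mul (r ^ a / Gamma a)
  refine (integrableOn_congr_fun (fun x hx => ?_) measurableSet_Ioi).1 h
  have hx : 0 < x := hx
  simp only [rpow_one]
  rw [show a + p - 1 = (a - 1) + p by ring, rpow_add hx, neg_mul]
  ring

lemma integral_rpow_gammaMeasure (ha : 0 < a) {p : ℝ} (hp : 0 < a + p) :
    ∫ x, x ^ p ∂(gammaMeasure a 1) = Gamma (a + p) / Gamma a := by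
  rw [integral_gammaMeasure ha one_pos]
  have h := integral_rpow_mul_exp_neg_mul_Ioi hp one_pos
  simp only [div_one, one_rpow, one_mul] at h
  rw [← h, ← integral_div]
  refine setIntegral_congr_fun measurableSet_Ioi fun x hx => ?_
  have hx : 0 < x := hx
  simp only [one_rpow, one_mul]
  rw [show a + p - 1 = (a - 1) + p by ring, rpow_add hx]
  ring

/-- The Laplace transform of the gamma distribution. -/
lemma integral_exp_neg_mul_gammaMeasure (ha : 0 < a) (hr : 0 < r) {c : ℝ} (hc : 0 ≤ c) :
    ∫ x, exp (-(c * x)) ∂(gammaMeasure a r) = (r / (r + c)) ^ a := by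
  have hrc : 0 < r + c := by linarith
  have hG := Gamma_pos_of_pos ha
  rw [integral_gammaMeasure ha hr]
  have h := integral_rpow_mul_exp_neg_mul_Ioi ha hrc
  calc ∫ x in Ioi 0, r ^ a / Gamma a * x ^ (a - 1) * exp (-(r * x)) * exp (-(c * x))
      = ∫ x in Ioi 0, r ^ a / Gamma a * (x ^ (a - 1) * exp (-((r + c) * x))) := by
        congr 1 with x
        rw [mul_assoc, ← exp_add]
        ring_nf
    _ = (r / (r + c)) ^ a := by
        rw [integral_const_mul, h, div_rpow zero_le_one hrc.le, div_rpow hr.le hrc.le, one_rpow]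
        field_simp

/-- The moments of the inverse gamma distribution with shape `a` are finite up to order `a`. -/
lemma integrable_inv_pow_gammaMeasure_iff (ha : 0 < a) {c : ℝ} (hc : 0 < c) (m : ℕ) :
    Integrable (fun x => (c / |x|) ^ m) (gammaMeasure a 1) ↔ (m : ℝ) < a := by
  have hG := Gamma_pos_of_pos ha
  constructor
  · intro h
    rw [integrable_gammaMeasure_iff ha one_pos] at h
    have h1 := h.mono_set (Ioo_subset_Ioi_self : Ioo (0 : ℝ) 1 ⊆ Ioi 0)
    -- On `(0, 1)` one has `1 ≤ e · exp(-x)`, so the density costs only a constant factor;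
    -- integrability of this power forces `a - 1 - m > -1`.
    have h2 : IntegrableOn (fun x : ℝ => x ^ (a - 1 - m)) (Ioo 0 1) := by
      refine (h1.const_mul (Gamma a * exp 1 / c ^ m)).mono'
        (Measurable.aestronglyMeasurable (by fun_prop)) ?_
      filter_upwards [ae_restrict_mem measurableSet_Ioo] with x hx
      have hx0 : 0 < x := hx.1
      have he : 1 ≤ exp 1 * exp (-x) := by
        rw [← exp_add]; exact one_le_exp (by linarith [hx.2])
      rw [Real.norm_of_nonneg (by positivity), abs_of_pos hx0, div_pow, rpow_sub hx0,
        rpow_natCast, one_rpow, one_mul]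
      calc x ^ (a - 1) / x ^ m = x ^ (a - 1) / x ^ m * 1 := by ring
        _ ≤ x ^ (a - 1) / x ^ m * (exp 1 * exp (-x)) := by gcongr
        _ = _ := by field_simp
    rw [intervalIntegral.integrableOn_Ioo_rpow_iff one_pos] at h2
    linarith
  · intro h
    have := (integrable_rpow_gammaMeasure ha one_pos (p := -m) (by linarith)).const_mul (c ^ m)
    refine this.congr ?_
    filter_upwards [ae_pos_gammaMeasure a 1] with x hx
    rw [abs_of_pos hx, div_pow, rpow_neg hx.le, rpow_natCast, div_eq_mul_inv]

end GammaMeasure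

/-! ### Matérn and Confluent Hypergeometric covariances as scale mixtures -/

section Covariances

variable {ν α β φ σsq h : ℝ}

/-- Substituting `x = (2 / z) s` turns the exponent `z (x + 1/x) / 2` into `s + z² / (4s)`: a gamma
weight times a Gaussian in `z`. -/
lemma besselK_eq_integral (p : ℝ) {z : ℝ} (hz : 0 < z) :
    besselK p z = (1 / 2) * (2 / z) ^ p *
      ∫ s in Ioi (0 : ℝ), s ^ (p - 1) * exp (-s) * exp (-(z ^ 2 / (4 * s))) := by
  have hb : 0 < 2 / z := by positivity
  have h := integral_comp_mul_left_Ioi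
    (fun x : ℝ => x ^ (p - 1) * exp (-(z * (x + 1 / x)) / 2)) 0 hb
  rw [mul_zero, smul_eq_mul] at h
  rw [besselK, show (2 / z) ^ p = 2 / z * (2 / z) ^ (p - 1) by
    rw [rpow_sub_one hb.ne']; field_simp]
  rw [mul_assoc (1 / 2 : ℝ)]
  congr 1
  rw [← mul_right_inj' (inv_ne_zero hb.ne'), ← h, mul_assoc, inv_mul_cancel_left₀ hb.ne',
    ← integral_const_mul]
  refine setIntegral_congr_fun measurableSet_Ioi fun s hs => ?_
  have hs : 0 < s := hs
  rw [mul_rpow hb.le hs.le, mul_assoc, mul_assoc, ← exp_add]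
  congr 3
  field_simp
  ring

/-- The Matérn covariance is a scale mixture of Gaussian covariances. -/
theorem maternCov_eq_integral (hν : 0 < ν) (hφ : 0 < φ) (hh : 0 ≤ h) :
    maternCov ν φ σsq h =
      ∫ s, σsq * exp (-(ν / (2 * φ ^ 2) / |s| * h ^ 2)) ∂(gammaMeasure ν 1) := by
  have hG := Gamma_pos_of_pos hν
  have := isProbabilityMeasure_gammaMeasure hν one_pos
  rcases hh.eq_or_lt with rfl | hh
  · simp [maternCov]
  have hz : 0 < √(2 * ν) / φ * h := by positivity
  rw [maternCov, if_neg hh.ne', besselK_eq_integral ν hz, integral_gammaMeasure hν one_pos]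
  set z := √(2 * ν) / φ * h with hz_def
  have hz2 : z ^ 2 = 2 * ν / φ ^ 2 * h ^ 2 := by
    rw [hz_def, mul_pow, div_pow, sq_sqrt (by positivity)]
  -- The Matérn normalisation cancels: `2^(1-ν) · z^ν · ½ · (2/z)^ν = 1`.
  have hc : σsq * (2 ^ (1 - ν) / Gamma ν) * z ^ ν * (1 / 2 * (2 / z) ^ ν *
      ∫ s in Ioi (0 : ℝ), s ^ (ν - 1) * exp (-s) * exp (-(z ^ 2 / (4 * s)))) =
      σsq / Gamma ν * ∫ s in Ioi (0 : ℝ), s ^ (ν - 1) * exp (-s) * exp (-(z ^ 2 / (4 * s))) := by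
    generalize ∫ s in Ioi (0 : ℝ), s ^ (ν - 1) * exp (-s) * exp (-(z ^ 2 / (4 * s))) = I
    rw [rpow_sub two_pos, rpow_one, div_rpow two_pos.le hz.le]
    field_simp
  rw [hc, ← integral_const_mul]
  refine setIntegral_congr_fun measurableSet_Ioi fun s hs => ?_
  have hs : 0 < s := hs
  simp only [one_rpow, one_mul]
  rw [abs_of_pos hs, hz2]
  have : 2 * ν / φ ^ 2 * h ^ 2 / (4 * s) = ν / (2 * φ ^ 2) / s * h ^ 2 := by
    field_simp
    ring
  rw [this]
  ring

/-- Under `v = 1/x` the inverse gamma scale becomes the gamma rate; the Jacobian `x^(-2)` turns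
`x^(a+1)` into `x^(a-1)`. -/
lemma setIntegral_mul_invGammaDensity {a b : ℝ} (ha : 0 < a) (hb : 0 < b) (f : ℝ → ℝ) :
    ∫ v in Ioi (0 : ℝ), f v * invGammaDensity a b v =
      ∫ x, f x⁻¹ ∂(gammaMeasure a b) := by
  rw [integral_gammaMeasure ha hb, ← integral_comp_rpow_Ioi _ (p := -1) (by norm_num)]
  refine setIntegral_congr_fun measurableSet_Ioi fun x hx => ?_
  have hx : 0 < x := hx
  simp only [invGammaDensity, smul_eq_mul, rpow_neg_one, abs_neg, abs_one, one_mul]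
  have e : x ^ (-1 - 1 : ℝ) * x⁻¹ ^ (-a - 1) = x ^ (a - 1) := by
    rw [← rpow_neg_one x, ← rpow_mul hx.le, ← rpow_add hx]
    congr 1
    ring
  rw [← e, div_inv_eq_mul, neg_mul]
  ring

lemma chCov_eq_integral_integral (hν : 0 < ν) (hα : 0 < α) (hβ : 0 < β) (hh : 0 ≤ h) :
    chCov ν α β σsq h = ∫ x, ∫ s, σsq * exp (-(ν / 2 * |x| / |s| * h ^ 2)) ∂(gammaMeasure ν 1)
      ∂(gammaMeasure α (β ^ 2 / 2)) := by
  rw [chCov, setIntegral_mul_invGammaDensity hα (by positivity)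
    fun v => maternCov ν (√v) σsq h]
  refine integral_congr_ae ?_
  filter_upwards [ae_pos_gammaMeasure α (β ^ 2 / 2)] with x hx
  rw [maternCov_eq_integral hν (by positivity) hh]
  congr 1 with s
  rw [sq_sqrt (by positivity), abs_of_pos hx]
  congr 5
  field_simp

/-- The Confluent Hypergeometric covariance is a scale mixture of Gaussian covariances. -/
theorem chCov_eq_integral (hν : 0 < ν) (hα : 0 < α) (hβ : 0 < β) (hh : 0 ≤ h) :
    chCov ν α β σsq h = ∫ p : ℝ × ℝ, σsq * exp (-(ν / 2 * |p.1| / |p.2| * h ^ 2))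
      ∂((gammaMeasure α (β ^ 2 / 2)).prod (gammaMeasure ν 1)) := by
  have := isProbabilityMeasure_gammaMeasure hν one_pos
  have := isProbabilityMeasure_gammaMeasure hα (show 0 < β ^ 2 / 2 by positivity)
  rw [chCov_eq_integral_integral hν hα hβ hh, integral_prod]
  refine (integrable_const |σsq|).mono'
      (Measurable.aestronglyMeasurable (by fun_prop)) (Eventually.of_forall fun p => ?_)
  rw [norm_mul, Real.norm_eq_abs, Real.norm_of_nonneg (exp_pos _).le]
  exact mul_le_of_le_one_right (abs_nonneg _) (exp_le_one_iff.2 (neg_nonpos.2 (by positivity)))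

/-- The two gamma variables are independent and the numerator has all positive moments, so only the
negative moments of the denominator matter; hence `α` and `β` have no influence. -/
lemma integrable_chMixing_pow_iff (hν : 0 < ν) (hα : 0 < α) (hβ : 0 < β) (m : ℕ) :
    Integrable (fun p : ℝ × ℝ => (ν / 2 * |p.1| / |p.2|) ^ m)
      ((gammaMeasure α (β ^ 2 / 2)).prod (gammaMeasure ν 1)) ↔ (m : ℝ) < ν := by
  have := isProbabilityMeasure_gammaMeasure hν one_pos
  have hb : 0 < β ^ 2 / 2 := by positivity
  have := isProbabilityMeasure_gammaMeasure hα hb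
  rw [← integrable_inv_pow_gammaMeasure_iff hν (show 0 < ν / 2 by positivity) m]
  constructor
  · intro h
    obtain ⟨x, hx, hx0⟩ := (h.prod_right_ae.and (ae_pos_gammaMeasure α (β ^ 2 / 2))).exists
    refine (hx.const_mul (|x| ^ m)⁻¹).congr (Eventually.of_forall fun s => ?_)
    have : |x| ^ m ≠ 0 := by positivity
    simp only [div_pow, mul_pow]
    field_simp
  · intro h
    have h1 : Integrable (fun x : ℝ => |x| ^ m) (gammaMeasure α (β ^ 2 / 2)) := by
      refine (integrable_rpow_gammaMeasure hα hb (p := m) (by positivity)).congr ?_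
      filter_upwards [ae_pos_gammaMeasure α (β ^ 2 / 2)] with x hx
      rw [rpow_natCast, abs_of_pos hx]
    refine (h1.mul_prod h).congr (Eventually.of_forall fun p => ?_)
    simp only [div_pow, mul_pow]
    ring

/-! ### Tail behavior -/

/-- After Fubini, the mixing over the inverse gamma law is a gamma Laplace transform in closed form,
whose algebraic decay produces the tail. -/
lemma chCov_eq_integral_rpow (hν : 0 < ν) (hα : 0 < α) (hβ : 0 < β) (hh : 0 ≤ h) :
    chCov ν α β σsq h = ∫ s, σsq * (β ^ 2 / 2 / (β ^ 2 / 2 + ν / 2 / |s| * h ^ 2)) ^ α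
      ∂(gammaMeasure ν 1) := by
  have := isProbabilityMeasure_gammaMeasure hν one_pos
  have hb : 0 < β ^ 2 / 2 := by positivity
  have := isProbabilityMeasure_gammaMeasure hα hb
  rw [chCov_eq_integral_integral hν hα hβ hh, integral_integral_swap]
  · congr 1 with s
    rw [integral_const_mul, ← integral_exp_neg_mul_gammaMeasure hα hb (by positivity)]
    congr 1
    refine integral_congr_ae ?_
    filter_upwards [ae_pos_gammaMeasure α (β ^ 2 / 2)] with x hx
    rw [abs_of_pos hx]
    congr 2
    ring
  · refine (integrable_const |σsq|).mono'
      (Measurable.aestronglyMeasurable (by fun_prop)) (Eventually.of_forall fun p => ?_)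
    rw [Function.uncurry_def, norm_mul, Real.norm_eq_abs, Real.norm_of_nonneg (exp_pos _).le]
    exact mul_le_of_le_one_right (abs_nonneg _) (exp_le_one_iff.2 (neg_nonpos.2 (by positivity)))

/-- Dominated convergence, with the pointwise limit `σsq (β² s / ν)^α` itself as the bound: dropping
the nonnegative term in `h^(-2)` from the denominator only increases the integrand. -/
theorem tendsto_rpow_mul_chCov (hν : 0 < ν) (hα : 0 < α) (hβ : 0 < β) (hσ : 0 < σsq) :
    Tendsto (fun h : ℝ => h ^ (2 * α) * chCov ν α β σsq h) atTop
      (𝓝 (σsq * β ^ (2 * α) * Gamma (ν + α) / (ν ^ α * Gamma ν))) := by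
  have hb : 0 < β ^ 2 / 2 := by positivity
  have hlim : σsq * β ^ (2 * α) * Gamma (ν + α) / (ν ^ α * Gamma ν) =
      ∫ s, σsq * (β ^ 2 / ν) ^ α * s ^ α ∂(gammaMeasure ν 1) := by
    rw [integral_const_mul, integral_rpow_gammaMeasure hν (by positivity),
      div_rpow (by positivity) hν.le, ← rpow_natCast β 2, ← rpow_mul hβ.le]
    push_cast
    field_simp
  have hpt : ∀ s h : ℝ, 0 < s → 0 < h →
      h ^ (2 * α) * (σsq * (β ^ 2 / 2 / (β ^ 2 / 2 + ν / 2 / |s| * h ^ 2)) ^ α) =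
        σsq * (β ^ 2 / 2 / (β ^ 2 / 2 * (h ^ 2)⁻¹ + ν / 2 / s)) ^ α := by
    intro s h hs hh
    rw [abs_of_pos hs, show h ^ (2 * α) = (h ^ 2) ^ α by
      rw [← rpow_natCast h 2, ← rpow_mul hh.le]; norm_num, mul_left_comm,
      ← mul_rpow (by positivity) (by positivity)]
    congr 2
    field_simp
  rw [hlim]
  have hEq : (fun h : ℝ => h ^ (2 * α) * chCov ν α β σsq h) =ᶠ[atTop] fun h : ℝ =>
      ∫ s, h ^ (2 * α) * (σsq * (β ^ 2 / 2 / (β ^ 2 / 2 + ν / 2 / |s| * h ^ 2)) ^ α)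
        ∂(gammaMeasure ν 1) := by
    filter_upwards [eventually_ge_atTop 0] with h hh
    rw [chCov_eq_integral_rpow hν hα hβ hh, ← integral_const_mul]
  refine (tendsto_congr' hEq).2 ?_
  refine tendsto_integral_filter_of_dominated_convergence
    (fun s => σsq * (β ^ 2 / ν) ^ α * s ^ α)
    (Eventually.of_forall fun h => Measurable.aestronglyMeasurable (by fun_prop)) ?_
    ((integrable_rpow_gammaMeasure hν one_pos (by positivity)).const_mul _) ?_
  · filter_upwards [eventually_gt_atTop 0] with h hh
    filter_upwards [ae_pos_gammaMeasure ν 1] with s hs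
    rw [hpt s h hs hh, Real.norm_of_nonneg (by positivity), mul_assoc,
      ← mul_rpow (by positivity) hs.le]
    gcongr
    calc β ^ 2 / 2 / (β ^ 2 / 2 * (h ^ 2)⁻¹ + ν / 2 / s) ≤ β ^ 2 / 2 / (ν / 2 / s) := by
          gcongr
          exact le_add_of_nonneg_left (by positivity)
      _ = β ^ 2 / ν * s := by field_simp
  · filter_upwards [ae_pos_gammaMeasure ν 1] with s hs
    have h0 : Tendsto (fun h : ℝ => (h ^ 2)⁻¹) atTop (𝓝 0) :=
      tendsto_inv_atTop_zero.comp (tendsto_pow_atTop two_ne_zero)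
    have h1 : Tendsto (fun h : ℝ => β ^ 2 / 2 / (β ^ 2 / 2 * (h ^ 2)⁻¹ + ν / 2 / s)) atTop
        (𝓝 (β ^ 2 / 2 / (β ^ 2 / 2 * 0 + ν / 2 / s))) :=
      tendsto_const_nhds.div ((h0.const_mul _).add_const _) (by positivity)
    rw [show β ^ 2 / 2 / (β ^ 2 / 2 * 0 + ν / 2 / s) = β ^ 2 / ν * s by field_simp; simp] at h1
    have h2 := (h1.rpow_const (p := α) (Or.inr hα.le)).const_mul σsq
    rw [mul_rpow (by positivity) hs.le, ← mul_assoc] at h2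
    refine h2.congr' ?_
    filter_upwards [eventually_gt_atTop 0] with h hh
    rw [hpt s h hs hh]

lemma tendsto_chSlow (hν : 0 < ν) (hβ : 0 < β) (hα : 0 < α) :
    Tendsto (chSlow ν α β) atTop (𝓝 1) := by
  have h1 : Tendsto (fun x : ℝ => x / (x + β ^ 2 / (2 * ν))) atTop (𝓝 1) := by
    have h2 : Tendsto (fun x : ℝ => (1 + β ^ 2 / (2 * ν) * x⁻¹)⁻¹) atTop
        (𝓝 (1 + β ^ 2 / (2 * ν) * 0)⁻¹) :=
      ((tendsto_inv_atTop_zero.const_mul _).const_add _).inv₀ (by simp)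
    rw [mul_zero, add_zero, inv_one] at h2
    refine h2.congr' ?_
    filter_upwards [eventually_gt_atTop 0] with x hx
    field_simp
  have h3 := h1.rpow_const (p := ν + α) (Or.inr (by positivity))
  rwa [one_rpow] at h3

/-- A function with a nonzero limit at infinity varies slowly. -/
lemma isSlowlyVarying_chSlow (hν : 0 < ν) (hα : 0 < α) (hβ : 0 < β) :
    IsSlowlyVarying (chSlow ν α β) := by
  refine ⟨⟨1, fun x hx => ?_, ?_⟩, fun t ht => ?_⟩
  · have : 0 < x := by linarith
    exact rpow_pos_of_pos (by positivity) _
  · have : Measurable (chSlow ν α β) := by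
      unfold chSlow
      fun_prop
    exact this.comp measurable_subtype_coe
  · have h := tendsto_chSlow hν hβ hα
    have h' := (h.comp (tendsto_id.const_mul_atTop ht)).div h one_ne_zero
    rwa [div_one] at h'

lemma isEquivalent_chCov (hν : 0 < ν) (hα : 0 < α) (hβ : 0 < β) (hσ : 0 < σsq) :
    (fun h : ℝ => chCov ν α β σsq h) ~[atTop]
      (fun h : ℝ => σsq * β ^ (2 * α) * Gamma (ν + α) / (ν ^ α * Gamma ν) *
        |h| ^ (-(2 * α)) * chSlow ν α β (h ^ 2)) := by
  have hK : 0 < σsq * β ^ (2 * α) * Gamma (ν + α) / (ν ^ α * Gamma ν) := by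
    have := Gamma_pos_of_pos hν
    have := Gamma_pos_of_pos (add_pos hν hα)
    positivity
  have hC := tendsto_rpow_mul_chCov hν hα hβ hσ
  set K := σsq * β ^ (2 * α) * Gamma (ν + α) / (ν ^ α * Gamma ν)
  have hL : Tendsto (fun h : ℝ => chSlow ν α β (h ^ 2)) atTop (𝓝 1) :=
    (tendsto_chSlow hν hβ hα).comp (tendsto_pow_atTop two_ne_zero)
  have hne : ∀ᶠ h : ℝ in atTop, 0 < h ∧ chSlow ν α β (h ^ 2) ≠ 0 :=
    (eventually_gt_atTop 0).and (hL.eventually_ne one_ne_zero)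
  rw [isEquivalent_iff_tendsto_one]
  · have := hC.div (hL.const_mul K) (by simpa using hK.ne')
    rw [mul_one, div_self hK.ne'] at this
    refine this.congr' ?_
    filter_upwards [hne] with h hh
    have hp := rpow_pos_of_pos hh.1 (2 * α)
    have := hh.2
    simp only [Pi.div_apply]
    rw [abs_of_pos hh.1, rpow_neg hh.1.le]
    field_simp
  · filter_upwards [hne] with h hh
    have := rpow_pos_of_pos (abs_pos.2 hh.1.ne') (-(2 * α))
    exact mul_ne_zero (mul_pos hK this).ne' hh.2

end Covariances

/-! ### Origin and tail behavior of the CH class -/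

theorem theorem2 (d : ℕ) (hd : 0 < d) (ν α β σsq : ℝ)
    (hν : 0 < ν) (hα : 0 < α) (hβ : 0 < β) (hσ : 0 < σsq) :
    -- (a) origin behavior: the CH covariance, and the fields that have it
    ((∀ m : ℕ,
        TimesDifferentiableAt (2 * m) (fun h : ℝ => chCov ν α β σsq |h|) 0 ↔ (m : ℝ) < ν) ∧
      (∀ {Ω : Type u} [MeasurableSpace Ω] (P : Measure Ω) [IsProbabilityMeasure P]
        (Z : EuclideanSpace ℝ (Fin d) → Ω → ℝ), IsIsotropicField P Z (chCov ν α β σsq) →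
        (∀ m : ℕ, IsMSDifferentiable P m Z ↔ (m : ℝ) < ν) ∧
        (∀ (m : ℕ) (e : EuclideanSpace ℝ (Fin d)), e ≠ 0 →
          (IsMSDifferentiableAlong P e m Z ↔ (m : ℝ) < ν)) ∧
        ((∀ n : ℕ, ν ≠ n) →
          IsMSDifferentiable P ⌊ν⌋₊ Z ∧ ¬ IsMSDifferentiable P (⌊ν⌋₊ + 1) Z)) ∧
      -- the same for every Matérn covariance with the same smoothness `ν`
      (∀ φ τsq : ℝ, 0 < φ → 0 < τsq →
        (∀ m : ℕ,
          TimesDifferentiableAt (2 * m) (fun h : ℝ => maternCov ν φ τsq |h|) 0 ↔ (m : ℝ) < ν) ∧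
        (∀ {Ω : Type u} [MeasurableSpace Ω] (P : Measure Ω) [IsProbabilityMeasure P]
          (Z : EuclideanSpace ℝ (Fin d) → Ω → ℝ), IsIsotropicField P Z (maternCov ν φ τsq) →
          (∀ m : ℕ, IsMSDifferentiable P m Z ↔ (m : ℝ) < ν) ∧
          (∀ (m : ℕ) (e : EuclideanSpace ℝ (Fin d)), e ≠ 0 →
            (IsMSDifferentiableAlong P e m Z ↔ (m : ℝ) < ν)) ∧
          ((∀ n : ℕ, ν ≠ n) →
            IsMSDifferentiable P ⌊ν⌋₊ Z ∧ ¬ IsMSDifferentiable P (⌊ν⌋₊ + 1) Z)))) ∧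
    -- (b) tail behavior
    (IsSlowlyVarying (chSlow ν α β) ∧
      (fun h : ℝ => chCov ν α β σsq h) ~[atTop]
        (fun h : ℝ => σsq * β ^ (2 * α) * Gamma (ν + α) / (ν ^ α * Gamma ν) *
          |h| ^ (-(2 * α)) * chSlow ν α β (h ^ 2))) := by
  -- The mixing space is left free: it is `ℝ × ℝ` for the CH class and `ℝ` for the Matérn class.
  have general : ∀ {F : ℝ → ℝ} {τsq : ℝ} {Λ : Type} [MeasurableSpace Λ] {ρ : Measure Λ}
      [IsFiniteMeasure ρ] {X : Λ → ℝ}, 0 < τsq → Measurable X → (∀ l, 0 ≤ X l) →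
      (∀ h, 0 ≤ h → F h = ∫ l, τsq * exp (-(X l * h ^ 2)) ∂ρ) →
      (∀ m : ℕ, Integrable (fun l => X l ^ m) ρ ↔ (m : ℝ) < ν) →
      (∀ m : ℕ, TimesDifferentiableAt (2 * m) (fun h : ℝ => F |h|) 0 ↔ (m : ℝ) < ν) ∧
      (∀ {Ω : Type u} [MeasurableSpace Ω] (P : Measure Ω) [IsProbabilityMeasure P]
        (Z : EuclideanSpace ℝ (Fin d) → Ω → ℝ), IsIsotropicField P Z F →
        (∀ m : ℕ, IsMSDifferentiable P m Z ↔ (m : ℝ) < ν) ∧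
        (∀ (m : ℕ) (e : EuclideanSpace ℝ (Fin d)), e ≠ 0 →
          (IsMSDifferentiableAlong P e m Z ↔ (m : ℝ) < ν)) ∧
        ((∀ n : ℕ, ν ≠ n) →
          IsMSDifferentiable P ⌊ν⌋₊ Z ∧ ¬ IsMSDifferentiable P (⌊ν⌋₊ + 1) Z)) := by
    intro F τsq Λ _ ρ _ X hτ hX hX0 hF hm
    refine ⟨timesDifferentiableAt_gaussianMixture_iff hX hX0 hF hτ hm, ?_⟩
    intro Ω _ P _ Z hZ
    obtain ⟨h1, h2⟩ := isMSDifferentiable_gaussianMixture_iff hd hX hX0 hF hτ hm hZ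
    refine ⟨h1, h2, fun hn => ⟨(h1 _).2 ?_, fun h => ?_⟩⟩
    · exact lt_of_le_of_ne (Nat.floor_le hν.le) (hn _).symm
    · have := (h1 _).1 h
      push_cast at this
      exact absurd this (Nat.lt_floor_add_one ν).not_gt
  have := isProbabilityMeasure_gammaMeasure hν one_pos
  have := isProbabilityMeasure_gammaMeasure hα (show 0 < β ^ 2 / 2 by positivity)
  refine ⟨and_assoc.1 ⟨?_, fun φ τsq hφ hτ => ?_⟩, isSlowlyVarying_chSlow hν hα hβ,
    isEquivalent_chCov hν hα hβ hσ⟩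
  -- The absolute values in the mixing variables make them nonnegative everywhere, although the
  -- gamma laws charge only positive reals.
  · exact general hσ (by fun_prop) (fun p => by positivity)
      (fun h hh => chCov_eq_integral hν hα hβ hh) (integrable_chMixing_pow_iff hν hα hβ)
  · exact general hτ (by fun_prop) (fun s => by positivity)
      (fun h hh => maternCov_eq_integral hν hφ hh)
      (integrable_inv_pow_gammaMeasure_iff hν (by positivity))
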